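/- Let $n\ge 1$ and let $\mathbf u=(u_1,\dots,u_n)\in\mathbb R^n_{\ge 0}\setminus\{\mathbf 0\}$ with $u_1\le u_2\le\dots\le u_n$. A vector $\mathbf a\in\mathbb R^n_{\ge 0}$ is a $\mathbf u$-parking function if its non-decreasing rearrangement $b_1\le\dots\le b_n$ satisfies $b_i\le u_i$ for all $i$; the parking function polytope $\mathrm{PF}(\mathbf u)\subset\mathbb R^n$ is the convex hull of all $\mathbf u$-parking functions. Then \[ \mathrm{PF}(\mathbf u)=\Big\{\mathbf x\in\mathbb R^n \;:\; x_i\ge 0 \text{ for all } i\in[n],\quad \sum_{i\in I}x_i\le \sum_{i=0}^{|I|-1}u_{n-i}\ \text{ for all } \emptyset\ne I\subseteq[n]\Big\}. \] An inequality $\mathbf a\cdot\mathbf x\le b$ valid on a polytope $P$ is said to define a facet of $P$ if $\{\mathbf x\in P:\mathbf a\cdot\mathbf x=b\}$ is a face of $P$ of dimension $\dim P-1$. For each $i\in[n]$, the inequality $x_i\ge 0$ defines a facet of $\mathrm{PF}(\mathbf u)$. For each nonempty $I\subseteq[n]$, whether the inequality $\sum_{i\in I}x_i\le\sum_{i=0}^{|I|-1}u_{n-i}$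 defines a facet of $\mathrm{PF}(\mathbf u)$ is determined as follows. \begin{enumerate} \item If $\mathbf u=(d,\dots,d)$ for some $d>0$, it defines a facet if and only if $|I|=1$. \item If $\mathbf u=(0,\dots,0,d)$ for some $d>0$, it defines a facet if and only if $|I|=n$. \item If $\mathbf u=(0,\dots,0,d,\dots,d)$ for some $d>0$, with at least one $0$ and at least two $d$'s, it defines a facet if and only if $|I|\in\{1,n\}$. \item If $\mathbf u$ contains at least two distinct positive entries, let $d_1<\dots<d_\ell$ be the distinct positive values among the entries of $\mathbf u$, let $m_0$ be the number of entries equal to $0$, and let $m_i$ be the number of entries equal to $d_i$ for $1\le i\le\ell$. Then it defines a facet if and only if $|I|\in\{1,n\}\cup[m_\ell+1,\,n-m_0-1]$, where $[p,q]$ denotes the set of integers $k$ with $p\le k\le q$ (empty if $p>q$). \end{enumerate} -/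

import Mathlib

open scoped Finset

/-- `a` is a `u`-parking function: its entries are nonnegative and its non-decreasing rearrangement
`b = a ∘ Tuple.sort a` satisfies `b i ≤ u i` for all `i`. -/
def IsParkingFunction {n : ℕ} (u a : Fin n → ℝ) : Prop :=
  (∀ i, 0 ≤ a i) ∧ ∀ i, (a ∘ Tuple.sort a) i ≤ u i

/-- The parking function polytope `PF(u)`: the convex hull of all `u`-parking functions. -/
def PF {n : ℕ} (u : Fin n → ℝ) : Set (Fin n → ℝ) :=
  convexHull ℝ {a | IsParkingFunction u a}

open Classical in
/-- The dimension of the affine span of a subset of `ℝⁿ`, with `dim ∅ = -1`. -/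
noncomputable def polyDim {n : ℕ} (P : Set (Fin n → ℝ)) : ℤ :=
  if P = ∅ then -1 else (Module.finrank ℝ (affineSpan ℝ P).direction : ℤ)

/-- Faces: the empty set and the sets of maximizers over `P` of linear functionals. -/
def IsFace {n : ℕ} (P F : Set (Fin n → ℝ)) : Prop :=
  F = ∅ ∨ ∃ h : Fin n → ℝ, F = {x | x ∈ P ∧ ∀ y ∈ P, h ⬝ᵥ y ≤ h ⬝ᵥ x}

/-- A facet of `P` is a face of dimension `dim P - 1`. -/
def IsFacet {n : ℕ} (P F : Set (Fin n → ℝ)) : Prop :=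
  IsFace P F ∧ polyDim F = polyDim P - 1

/-- The inequality `a ⬝ᵥ x ≤ b` is valid on `P` and defines a facet of `P`. -/
def DefinesFacet {n : ℕ} (P : Set (Fin n → ℝ)) (a : Fin n → ℝ) (b : ℝ) : Prop :=
  (∀ x ∈ P, a ⬝ᵥ x ≤ b) ∧ IsFacet P {x | x ∈ P ∧ a ⬝ᵥ x = b}

/-- The vector `e_I`, the sum of the standard basis vectors `e_i` over `i ∈ I`. -/
def indicatorVec {n : ℕ} (I : Finset (Fin n)) : Fin n → ℝ := fun i => if i ∈ I then 1 else 0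

/-- `u_n + u_{n-1} + ⋯ + u_{n-k+1}` (indices starting at `1`), for `k ≤ n`: the entry of `u` at
`j.rev` is `u_{n-j}`. -/
noncomputable def topSum {n : ℕ} (u : Fin n → ℝ) (k : ℕ) : ℝ :=
  ∑ j : Fin n with j.val < k, u j.rev

/-- The number of entries of `u` that are equal to `d`. -/
noncomputable def entryCount {n : ℕ} (u : Fin n → ℝ) (d : ℝ) : ℕ := #{i : Fin n | u i = d}

/-- The set of positive values appearing in `u`. -/
noncomputable def posValues {n : ℕ} (u : Fin n → ℝ) : Finset ℝ :=
  {d ∈ Finset.univ.image u | 0 < d}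

/-- The number `ℓ` of distinct positive values appearing in `u`. -/
noncomputable def numPosValues {n : ℕ} (u : Fin n → ℝ) : ℕ := (posValues u).card

/-- The data vector `(d_1, …, d_ℓ)`: the positive values appearing in `u`, in increasing order. -/
noncomputable def dataVector {n : ℕ} (u : Fin n → ℝ) : Fin (numPosValues u) → ℝ :=
  (posValues u).orderEmbOfFin rfl

/-- The multiplicity vector `(m_0, m_1, …, m_ℓ)`: `m_0` is the number of zeros of `u`, and `m_i` is
the number of entries of `u` equal to `d_i`. -/
noncomputable def multiplicityVector {n : ℕ} (u : Fin n → ℝ) : Fin (numPosValues u + 1) → ℕ :=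
  Fin.cons (entryCount u 0) fun i => entryCount u (dataVector u i)

/-!
A linear functional `h` on the region cut out by the inequalities is maximized greedily: list the
coordinates in increasing order of `h`, place the entries of `u` in that order and put `0` wherever
`h` is not positive. Summation by parts shows that this vector, a parking function, beats every
point of the region, so by separation the region is `PF u`.

Facets are read off from the directions of the face `F` on which the inequality of `I` is tight.
A rearrangement of `u` whose largest entries sit on `I` lies in `F`, and `F` is stable under
swapping two coordinates on the same side of `I` and under putting `0` at a coordinate outside `I`.
Hence its directions fill the hyperplane `e_I ⬝ᵥ v = 0` as soon as this rearrangement is not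
constant on `I` (or `#I = 1`) and not zero outside `I` (or `#I = n`). Conversely, if the `#I`
largest entries of `u` agree, then all points of `F` share one constant value on `I`, and if the
other entries of `u` vanish, then all points of `F` vanish outside `I`.
-/

section Finset

variable {ι R : Type*}

lemma sum_le_sum_of_card_eq [DecidableEq ι] [AddCommGroup R] [PartialOrder R]
    [IsOrderedAddMonoid R] {s t : Finset ι} {f : ι → R} (hst : #s = #t)
    (hf : ∀ i ∈ s \ t, ∀ j ∈ t \ s, f i ≤ f j) : ∑ i ∈ s, f i ≤ ∑ j ∈ t, f j := by
  have e : ↥(s \ t) ≃ ↥(t \ s) := Finset.equivOfCardEq (Finset.card_sdiff_comm hst)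
  rw [← Finset.sum_sdiff_le_sum_sdiff, ← Finset.sum_coe_sort, ← Finset.sum_coe_sort (t \ s),
    ← e.sum_comp]
  exact Finset.sum_le_sum fun i _ => hf i i.2 (e i) (e i).2

lemma mul_sum_le_sum_mul_of_monotoneOn [LinearOrder ι] [Ring R] [PartialOrder R] [IsOrderedRing R]
    {s : Finset ι} {g w : ι → R} {c : R} (hg : MonotoneOn g s)
    (hw : ∀ k ∈ s, 0 ≤ ∑ j ∈ s with k ≤ j, w j) (hc : ∀ i ∈ s, c ≤ g i) :
    c * ∑ i ∈ s, w i ≤ ∑ i ∈ s, g i * w i := by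
  induction s using Finset.induction_on_min generalizing c with
  | empty => simp
  | insert a s hmin ih =>
    have ha : a ∉ s := fun h => lt_irrefl a (hmin a h)
    have htotal : 0 ≤ ∑ i ∈ insert a s, w i := by
      have h := hw a (Finset.mem_insert_self a s)
      rwa [Finset.filter_true_of_mem] at h
      exact fun j hj => (Finset.mem_insert.1 hj).elim (fun h => h.ge) fun h => (hmin j h).le
    have htail : g a * ∑ i ∈ s, w i ≤ ∑ i ∈ s, g i * w i := by
      refine ih (hg.mono (by simp)) (fun k hk => ?_) fun i hi =>
        hg (by simp) (by simp [hi]) (hmin i hi).le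
      simpa [Finset.filter_insert, (hmin k hk).not_ge] using hw k (Finset.mem_insert_of_mem hk)
    calc c * ∑ i ∈ insert a s, w i ≤ g a * ∑ i ∈ insert a s, w i :=
          mul_le_mul_of_nonneg_right (hc a (Finset.mem_insert_self a s)) htotal
      _ = g a * w a + g a * ∑ i ∈ s, w i := by rw [Finset.sum_insert ha, mul_add]
      _ ≤ g a * w a + ∑ i ∈ s, g i * w i := by gcongr
      _ = ∑ i ∈ insert a s, g i * w i := by rw [Finset.sum_insert ha]

lemma sum_mul_le_sum_mul_of_monotone [LinearOrder ι] [Fintype ι] [LocallyFiniteOrderTop ι] [Ring R]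
    [PartialOrder R] [IsOrderedRing R] {g x y : ι → R} (hg : Monotone g) (hg0 : ∀ i, 0 ≤ g i)
    (hxy : ∀ k, ∑ j ∈ Finset.Ici k, x j ≤ ∑ j ∈ Finset.Ici k, y j) :
    ∑ i, g i * x i ≤ ∑ i, g i * y i := by
  have h := mul_sum_le_sum_mul_of_monotoneOn (s := Finset.univ) (w := y - x) (hg.monotoneOn _)
    (fun k _ => by simpa [Finset.filter_le_eq_Ici] using hxy k) fun i _ => hg0 i
  simpa [mul_sub] using h

open scoped Pointwise in
lemma exists_perm_forall_mem_iff {s t : Finset ι} (h : #s = #t) :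
    ∃ σ : Equiv.Perm ι, ∀ i, i ∈ s ↔ σ i ∈ t := by
  classical
  obtain ⟨σ, hσ⟩ := (Set.powersetCard.isPretransitive (α := ι) (n := #t)).exists_smul_eq
    ⟨s, h⟩ ⟨t, rfl⟩
  refine ⟨σ, fun i => ?_⟩
  have hst : σ • s = t := congrArg Subtype.val hσ
  rw [← hst, ← Equiv.Perm.smul_def, Finset.smul_mem_smul_finset_iff]

end Finset

lemma mem_convexHull_of_forall_dotProduct_le {ι : Type*} [Fintype ι] {s : Set (ι → ℝ)} {x : ι → ℝ}
    (hs : IsClosed (convexHull ℝ s)) (h : ∀ a : ι → ℝ, ∃ y ∈ s, a ⬝ᵥ x ≤ a ⬝ᵥ y) :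
    x ∈ convexHull ℝ s := by
  classical
  by_contra hx
  obtain ⟨f, c, hlt, hc⟩ := geometric_hahn_banach_closed_point (convex_convexHull ℝ s) hs hx
  obtain ⟨a, ha⟩ := (dotProductEquiv ℝ ι).surjective f.toLinearMap
  have hf (y : ι → ℝ) : f y = a ⬝ᵥ y := (LinearMap.congr_fun ha y).symm
  obtain ⟨y, hy, hxy⟩ := h a
  rw [← hf, ← hf] at hxy
  exact absurd ((hlt y (subset_convexHull ℝ s hy)).trans hc) hxy.not_gt

section CoordinateVectors

variable {ι K : Type*} [DecidableEq ι]

lemma mem_of_forall_single_mem [Finite ι] [Semiring K] {D : Submodule K (ι → K)} {v : ι → K}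
    (h : ∀ j, v j ≠ 0 → Pi.single j 1 ∈ D) : v ∈ D := by
  cases nonempty_fintype ι
  rw [pi_eq_sum_univ' v]
  refine D.sum_mem fun j _ => ?_
  by_cases hj : v j = 0
  · simp [hj]
  · exact D.smul_mem _ (by simpa only [Pi.single_apply] using h j hj)

lemma single_sub_single_mem_of_forall_ne [Ring K] {α : Type*} {D : Submodule K (ι → K)}
    {s : Set ι} {x : ι → α}
    (hD : ∀ i ∈ s, ∀ j ∈ s, x i ≠ x j → (Pi.single i 1 - Pi.single j 1 : ι → K) ∈ D)
    (hx : ∃ i ∈ s, ∃ j ∈ s, x i ≠ x j) {i j : ι} (hi : i ∈ s) (hj : j ∈ s) :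
    (Pi.single i 1 - Pi.single j 1 : ι → K) ∈ D := by
  by_cases hij : x i = x j
  · obtain ⟨r, hr, hir⟩ : ∃ r ∈ s, x i ≠ x r := by
      by_contra! hconst
      obtain ⟨p, hp, q, hq, hpq⟩ := hx
      exact hpq ((hconst p hp).symm.trans (hconst q hq))
    simpa using D.add_mem (hD i hi r hr hir) (hD r hr j hj (hij ▸ hir.symm))
  · exact hD i hi j hj hij

variable [Field K] {F : Set (ι → K)} {x : ι → K} {i j : ι}

lemma single_mem_vectorSpan_of_update_zero_mem (hx : x ∈ F) (hx' : Function.update x i 0 ∈ F)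
    (hi : x i ≠ 0) : Pi.single i 1 ∈ vectorSpan K F := by
  rw [← Submodule.smul_mem_iff _ hi]
  convert vsub_mem_vectorSpan K hx hx' using 1
  ext j
  rcases eq_or_ne j i with rfl | hj <;> simp [*]

lemma single_mem_vectorSpan_of_single_mem {c : K} (hc : c ≠ 0) (h0 : 0 ∈ F)
    (h : Pi.single i c ∈ F) : Pi.single i 1 ∈ vectorSpan K F :=
  single_mem_vectorSpan_of_update_zero_mem h
    (by rwa [Pi.single, Function.update_idem, ← Pi.single, Pi.single_zero]) (by simpa using hc)

lemma single_sub_single_mem_vectorSpan_of_comp_swap_mem (hx : x ∈ F) (hx' : x ∘ Equiv.swap i j ∈ F)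
    (hij : x i ≠ x j) : (Pi.single i 1 - Pi.single j 1 : ι → K) ∈ vectorSpan K F := by
  rw [← Submodule.smul_mem_iff _ (sub_ne_zero.2 hij)]
  convert vsub_mem_vectorSpan K hx hx' using 1
  have hne : i ≠ j := fun h => hij (congrArg x h)
  ext k
  rcases eq_or_ne k i with rfl | hki
  · simp [hne]
  rcases eq_or_ne k j with rfl | hkj
  · simp [hne.symm]
  · simp [hki, hkj, Equiv.swap_apply_of_ne_of_ne]

end CoordinateVectors

lemma vectorSpan_le_ker {K V W : Type*} [Ring K] [AddCommGroup V] [Module K V] [AddCommGroup W]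
    [Module K W] {F : Set V} (f : V →ₗ[K] W) {c : W} (h : ∀ x ∈ F, f x = c) :
    vectorSpan K F ≤ LinearMap.ker f := by
  rw [vectorSpan_def, Submodule.span_le]
  rintro _ ⟨x, hx, y, hy, rfl⟩
  simp [h x hx, h y hy]

section Facets

variable {n : ℕ} {P : Set (Fin n → ℝ)} {a : Fin n → ℝ} {b : ℝ}

lemma polyDim_of_nonempty (hP : P.Nonempty) :
    polyDim P = Module.finrank ℝ (vectorSpan ℝ P) := by
  rw [polyDim, if_neg hP.ne_empty, direction_affineSpan]

lemma isFace_setOf_dotProduct_eq (hvalid : ∀ x ∈ P, a ⬝ᵥ x ≤ b) :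
    IsFace P {x | x ∈ P ∧ a ⬝ᵥ x = b} := by
  rcases Set.eq_empty_or_nonempty {x | x ∈ P ∧ a ⬝ᵥ x = b} with hempty | ⟨x₀, hx₀P, hx₀⟩
  · exact Or.inl hempty
  · refine Or.inr ⟨a, Set.ext fun x => and_congr_right fun hx => ⟨?_, fun hmax => ?_⟩⟩
    · rintro rfl
      exact hvalid
    · exact (hvalid x hx).antisymm (hx₀ ▸ hmax x₀ hx₀P)

lemma finrank_ker_dotProduct_add_one (ha : a ≠ 0) :
    Module.finrank ℝ (LinearMap.ker (dotProductEquiv ℝ (Fin n) a)) + 1 = n := by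
  simpa using Module.Dual.finrank_ker_add_one_of_ne_zero
    ((dotProductEquiv ℝ (Fin n)).map_ne_zero_iff.2 ha)

lemma definesFacet_iff_forall_mem_vectorSpan (hP : vectorSpan ℝ P = ⊤) (ha : a ≠ 0)
    (hvalid : ∀ x ∈ P, a ⬝ᵥ x ≤ b) (hne : {x | x ∈ P ∧ a ⬝ᵥ x = b}.Nonempty) :
    DefinesFacet P a b ↔
      ∀ v, a ⬝ᵥ v = 0 → v ∈ vectorSpan ℝ {x | x ∈ P ∧ a ⬝ᵥ x = b} := by
  set F := {x | x ∈ P ∧ a ⬝ᵥ x = b}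
  have hle : vectorSpan ℝ F ≤ LinearMap.ker (dotProductEquiv ℝ (Fin n) a) :=
    vectorSpan_le_ker _ fun x hx => hx.2
  have hdimP : polyDim P = n := by
    rw [polyDim_of_nonempty (hne.mono (Set.sep_subset P _)), hP, finrank_top,
      Module.finrank_fin_fun]
  have hker := finrank_ker_dotProduct_add_one ha
  calc DefinesFacet P a b ↔ polyDim F = polyDim P - 1 :=
        ⟨fun h => h.2.2, fun h => ⟨hvalid, isFace_setOf_dotProduct_eq hvalid, h⟩⟩
    _ ↔ Module.finrank ℝ (vectorSpan ℝ F) =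
          Module.finrank ℝ (LinearMap.ker (dotProductEquiv ℝ (Fin n) a)) := by
        rw [hdimP, polyDim_of_nonempty hne]
        omega
    _ ↔ LinearMap.ker (dotProductEquiv ℝ (Fin n) a) ≤ vectorSpan ℝ F :=
        ⟨fun h => (Submodule.eq_of_le_of_finrank_eq hle h).ge,
          fun h => congrArg (fun D : Submodule ℝ (Fin n → ℝ) => Module.finrank ℝ D)
            (hle.antisymm h)⟩

end Facets

section IndicatorVec

variable {n : ℕ} {I : Finset (Fin n)}

lemma indicatorVec_dotProduct (I : Finset (Fin n)) (x : Fin n → ℝ) :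
    indicatorVec I ⬝ᵥ x = ∑ i ∈ I, x i := by
  simp [indicatorVec, dotProduct]

lemma indicatorVec_ne_zero (hI : I.Nonempty) : indicatorVec I ≠ 0 := by
  obtain ⟨i, hi⟩ := hI
  exact fun h => by simpa [indicatorVec, hi] using congrFun h i

lemma forall_indicatorVec_dotProduct_eq_zero_imp_mem_iff (hI : I.Nonempty)
    (D : Submodule ℝ (Fin n → ℝ)) :
    (∀ v, indicatorVec I ⬝ᵥ v = 0 → v ∈ D) ↔
      (∀ i ∈ I, ∀ j ∈ I, (Pi.single i 1 - Pi.single j 1 : Fin n → ℝ) ∈ D) ∧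
        ∀ k ∉ I, (Pi.single k 1 : Fin n → ℝ) ∈ D := by
  constructor
  · refine fun h => ⟨fun i hi j hj => h _ ?_, fun k hk => h _ ?_⟩
    · simp [indicatorVec, hi, hj]
    · simp [indicatorVec, hk]
  · rintro ⟨hsub, hsingle⟩ v hv
    obtain ⟨i₀, hi₀⟩ := hI
    rw [indicatorVec_dotProduct] at hv
    have hdecomp : v = ∑ i ∈ I, v i • (Pi.single i 1 - Pi.single i₀ 1 : Fin n → ℝ) +
        ∑ k ∈ Iᶜ, v k • (Pi.single k 1 : Fin n → ℝ) := by
      simp only [smul_sub, Finset.sum_sub_distrib]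
      rw [← Finset.sum_smul, hv, zero_smul, sub_zero, Finset.sum_add_sum_compl]
      ext j
      simp [Finset.sum_apply, Pi.single_apply]
    rw [hdecomp]
    exact D.add_mem (D.sum_mem fun i hi => D.smul_mem _ (hsub i hi i₀ hi₀))
      (D.sum_mem fun k hk => D.smul_mem _ (hsingle k (Finset.mem_compl.1 hk)))

end IndicatorVec

section TopSum

variable {n k : ℕ} {u : Fin n → ℝ}

/-- The positions of the last `k` entries of a vector of length `n`, which are its `k` largest
entries if it is monotone. For `k ≥ n` these are all positions. -/
def topIndices (n k : ℕ) : Finset (Fin n) :=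
  ({j : Fin n | j.val < k} : Finset (Fin n)).map Fin.revPerm.toEmbedding

lemma mem_topIndices {j : Fin n} : j ∈ topIndices n k ↔ n ≤ j.val + k := by
  simp only [topIndices, Finset.mem_map_equiv, Finset.mem_filter_univ, Fin.revPerm_symm,
    Fin.revPerm_apply, Fin.val_rev]
  omega

lemma card_topIndices (hk : k ≤ n) : #(topIndices n k) = k := by
  rw [topIndices, Finset.card_map, Fin.card_filter_val_lt, min_eq_right hk]

lemma topSum_eq_sum_topIndices (u : Fin n → ℝ) (k : ℕ) :
    topSum u k = ∑ j ∈ topIndices n k, u j := by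
  simp [topSum, topIndices]

lemma sum_Ici_eq_topSum (u : Fin n → ℝ) (k : Fin n) :
    ∑ j ∈ Finset.Ici k, u j = topSum u #(Finset.Ici k) := by
  rw [topSum_eq_sum_topIndices]
  congr 1
  ext j
  rw [mem_topIndices, Finset.mem_Ici, Fin.card_Ici, Fin.le_def]
  omega

lemma topSum_card_univ (u : Fin n → ℝ) : topSum u #(Finset.univ : Finset (Fin n)) = ∑ i, u i := by
  simpa [topSum] using Equiv.sum_comp Fin.revPerm u

lemma sum_le_topSum (hu : Monotone u) (J : Finset (Fin n)) : ∑ j ∈ J, u j ≤ topSum u #J := by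
  rw [topSum_eq_sum_topIndices]
  refine sum_le_sum_of_card_eq (card_topIndices (card_finset_fin_le J)).symm fun i hi j hj => hu ?_
  rw [Finset.mem_sdiff, mem_topIndices] at hi hj
  exact Fin.le_def.2 (by omega)

lemma topSum_le_mul (hk : k ≤ n) {d : ℝ} (hd : ∀ i, u i ≤ d) : topSum u k ≤ k * d := by
  rw [topSum_eq_sum_topIndices, ← nsmul_eq_mul]
  simpa [card_topIndices hk] using Finset.sum_le_card_nsmul (topIndices n k) u d fun i _ => hd i

lemma mul_le_topSum_of_le_entryCount (hu : Monotone u) {d : ℝ} (hk : k ≤ entryCount u d) :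
    k * d ≤ topSum u k := by
  obtain ⟨J, hJ, rfl⟩ := Finset.exists_subset_card_eq hk
  calc #J * d = ∑ j ∈ J, u j := by
        rw [Finset.sum_congr rfl fun j hj => (Finset.mem_filter.1 (hJ hj)).2, Finset.sum_const,
          nsmul_eq_mul]
    _ ≤ topSum u #J := sum_le_topSum hu J

lemma sum_le_topSum_of_le_add_entryCount_zero (hu : Monotone u) (hkn : k ≤ n)
    (hk : n ≤ k + entryCount u 0) : ∑ i, u i ≤ topSum u k := by
  have hsupport : #{i | u i ≠ 0} ≤ k := by
    have h := Finset.card_filter_add_card_filter_not (s := .univ) fun i => u i = 0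
    rw [Finset.card_univ, Fintype.card_fin] at h
    rw [entryCount] at hk
    lia
  obtain ⟨J, hJ, rfl⟩ := Finset.exists_superset_card_eq hsupport (by simpa using hkn)
  calc ∑ i, u i = ∑ j ∈ J, u j := by
        refine (Finset.sum_subset J.subset_univ fun i _ hi => ?_).symm
        by_contra h
        exact hi (hJ (by simpa using h))
    _ ≤ topSum u #J := sum_le_topSum hu J

end TopSum

section ParkingRegion

variable {n : ℕ} {u x a : Fin n → ℝ}

/-- The polyhedron cut out by the inequalities `0 ≤ x i` and `∑ i ∈ I, x i ≤ topSum u #I`, which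
turns out to be `PF u`. -/
def parkingRegion (u : Fin n → ℝ) : Set (Fin n → ℝ) :=
  {x | (∀ I : Finset (Fin n), I.Nonempty → ∑ i ∈ I, x i ≤ topSum u #I) ∧ ∀ i, 0 ≤ x i}

lemma convex_parkingRegion (u : Fin n → ℝ) : Convex ℝ (parkingRegion u) := by
  simp only [parkingRegion, Set.ofPred_and, Set.ofPred_forall, ← indicatorVec_dotProduct]
  exact (convex_iInter₂ fun I _ => convex_halfSpace_le (dotProductEquiv ℝ _ _).isLinear _).inter
    (convex_iInter fun i => convex_halfSpace_ge (LinearMap.proj i).isLinear 0)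

lemma comp_perm_mem_parkingRegion (hx : x ∈ parkingRegion u) (σ : Equiv.Perm (Fin n)) :
    x ∘ σ ∈ parkingRegion u := by
  refine ⟨fun I hI => ?_, fun i => hx.2 (σ i)⟩
  simpa using hx.1 (I.map σ.toEmbedding) hI.map

lemma mem_parkingRegion_of_le (hx : x ∈ parkingRegion u) (ha : 0 ≤ a) (hax : a ≤ x) :
    a ∈ parkingRegion u :=
  ⟨fun I hI => (Finset.sum_le_sum fun i _ => hax i).trans (hx.1 I hI), ha⟩

lemma update_zero_mem_parkingRegion (hx : x ∈ parkingRegion u) (i : Fin n) :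
    Function.update x i 0 ∈ parkingRegion u :=
  mem_parkingRegion_of_le hx (le_update_iff.2 ⟨le_rfl, fun j _ => hx.2 j⟩)
    (update_le_self_iff.2 (hx.2 i))

lemma self_mem_parkingRegion (hu : Monotone u) (hu0 : ∀ i, 0 ≤ u i) : u ∈ parkingRegion u :=
  ⟨fun I _ => sum_le_topSum hu I, hu0⟩

lemma zero_mem_parkingRegion (hu : Monotone u) (hu0 : ∀ i, 0 ≤ u i) :
    (0 : Fin n → ℝ) ∈ parkingRegion u :=
  mem_parkingRegion_of_le (self_mem_parkingRegion hu hu0) le_rfl hu0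

lemma single_mem_parkingRegion (hu : Monotone u) (hu0 : ∀ i, 0 ≤ u i) (i p : Fin n) :
    Pi.single i (u p) ∈ parkingRegion u :=
  mem_parkingRegion_of_le
    (comp_perm_mem_parkingRegion (self_mem_parkingRegion hu hu0) (Equiv.swap i p))
    (Pi.single_nonneg.2 (hu0 p)) (update_le_iff.2 ⟨by simp, fun _ _ => hu0 _⟩)

lemma isParkingFunction_iff_exists_perm (hu : Monotone u) :
    IsParkingFunction u a ↔ (∀ i, 0 ≤ a i) ∧ ∃ σ : Equiv.Perm (Fin n), a ≤ u ∘ σ := by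
  refine and_congr_right fun _ => ⟨fun h => ⟨(Tuple.sort a).symm, fun i => ?_⟩, ?_⟩
  · simpa using h ((Tuple.sort a).symm i)
  · rintro ⟨σ, hσ⟩ i
    rw [← Tuple.lt_card_le_iff_apply_le_of_monotone (Tuple.monotone_sort a)]
    have hsub : (Finset.Iic i).map ((Tuple.sort a).trans σ).symm.toEmbedding ⊆
        ({j | (a ∘ Tuple.sort a) j ≤ u i} : Finset (Fin n)) := by
      intro j hj
      rw [Finset.mem_map_equiv, Finset.mem_Iic] at hj
      simpa using (hσ (Tuple.sort a j)).trans (hu hj)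
    have hcard := Finset.card_le_card hsub
    rw [Finset.card_map, Fin.card_Iic] at hcard
    omega

lemma IsParkingFunction.mem_parkingRegion (hu : Monotone u) (hu0 : ∀ i, 0 ≤ u i)
    (ha : IsParkingFunction u a) : a ∈ parkingRegion u := by
  obtain ⟨ha0, σ, hσ⟩ := (isParkingFunction_iff_exists_perm hu).1 ha
  exact mem_parkingRegion_of_le
    (comp_perm_mem_parkingRegion (self_mem_parkingRegion hu hu0) σ) ha0 hσ

/-- The vectors obtained from `u` by permuting its entries and replacing some of them by `0`. They
are finitely many parking functions, among which every linear functional on the parking region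
attains its maximum. -/
def truncatedRearrangements (u : Fin n → ℝ) : Set (Fin n → ℝ) :=
  Set.range fun p : Equiv.Perm (Fin n) × Set (Fin n) => p.2.indicator (u ∘ p.1)

lemma isParkingFunction_of_mem_truncatedRearrangements (hu : Monotone u) (hu0 : ∀ i, 0 ≤ u i)
    (ha : a ∈ truncatedRearrangements u) : IsParkingFunction u a := by
  obtain ⟨⟨σ, S⟩, rfl⟩ := ha
  exact (isParkingFunction_iff_exists_perm hu).2
    ⟨Set.indicator_nonneg fun i _ => hu0 (σ i), σ, Set.indicator_le_self' fun i _ => hu0 (σ i)⟩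

lemma exists_truncatedRearrangement_dotProduct_le (hx : x ∈ parkingRegion u) (h : Fin n → ℝ) :
    ∃ y ∈ truncatedRearrangements u, h ⬝ᵥ x ≤ h ⬝ᵥ y := by
  set g : Fin n → ℝ := fun i => max (h i) 0 with hg
  set τ := Tuple.sort g
  refine ⟨_, ⟨(τ.symm, {i | 0 < h i}), rfl⟩, ?_⟩
  calc h ⬝ᵥ x ≤ ∑ i, g i * x i :=
        Finset.sum_le_sum fun i _ => mul_le_mul_of_nonneg_right (le_max_left _ _) (hx.2 i)
    _ = ∑ j, g (τ j) * x (τ j) := (Equiv.sum_comp τ fun i => g i * x i).symm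
    _ ≤ ∑ j, g (τ j) * u j :=
        sum_mul_le_sum_mul_of_monotone (Tuple.monotone_sort g) (fun j => le_max_right _ _)
          fun k => ((comp_perm_mem_parkingRegion hx τ).1 _ Finset.nonempty_Ici).trans_eq
            (sum_Ici_eq_topSum u k).symm
    _ = ∑ i, g i * u (τ.symm i) := by
        simpa using Equiv.sum_comp τ fun i => g i * u (τ.symm i)
    _ = h ⬝ᵥ {i | 0 < h i}.indicator (u ∘ τ.symm) := by
        refine Finset.sum_congr rfl fun i _ => ?_
        rcases lt_or_ge 0 (h i) with hi | hi
        · simp [hg, hi, hi.le]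
        · simp [hg, hi, hi.not_gt]

theorem PF_eq_parkingRegion (hu : Monotone u) (hu0 : ∀ i, 0 ≤ u i) : PF u = parkingRegion u := by
  apply Set.Subset.antisymm
  · exact convexHull_min (fun a ha => ha.mem_parkingRegion hu hu0) (convex_parkingRegion u)
  · intro x hx
    exact convexHull_mono (fun a => isParkingFunction_of_mem_truncatedRearrangements hu hu0)
      (mem_convexHull_of_forall_dotProduct_le ((Set.finite_range _).isClosed_convexHull ℝ)
        (exists_truncatedRearrangement_dotProduct_le hx))

end ParkingRegion

section SubsetFace

variable {n : ℕ} {u x : Fin n → ℝ} {I : Finset (Fin n)} {d : ℝ}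

/-- The points of the parking region at which the inequality of `I` is tight, in the form in which
`DefinesFacet` refers to them. -/
def subsetFace (u : Fin n → ℝ) (I : Finset (Fin n)) : Set (Fin n → ℝ) :=
  {x | x ∈ parkingRegion u ∧ indicatorVec I ⬝ᵥ x = topSum u #I}

lemma mem_subsetFace : x ∈ subsetFace u I ↔ x ∈ parkingRegion u ∧ ∑ i ∈ I, x i = topSum u #I := by
  rw [← indicatorVec_dotProduct]
  rfl

lemma comp_swap_mem_subsetFace (hx : x ∈ subsetFace u I) {i j : Fin n} (hij : i ∈ I ↔ j ∈ I) :
    x ∘ Equiv.swap i j ∈ subsetFace u I := by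
  rw [mem_subsetFace] at hx ⊢
  refine ⟨comp_perm_mem_parkingRegion hx.1 _, hx.2 ▸ ?_⟩
  refine Finset.sum_equiv (Equiv.swap i j) (fun k => ?_) fun _ _ => rfl
  rcases eq_or_ne k i with rfl | hki
  · simpa using hij
  rcases eq_or_ne k j with rfl | hkj
  · simpa using hij.symm
  · rw [Equiv.swap_apply_of_ne_of_ne hki hkj]

lemma update_zero_mem_subsetFace (hx : x ∈ subsetFace u I) {k : Fin n} (hk : k ∉ I) :
    Function.update x k 0 ∈ subsetFace u I := by
  rw [mem_subsetFace] at hx ⊢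
  exact ⟨update_zero_mem_parkingRegion hx.1 k, by rw [Finset.sum_update_of_notMem hk, hx.2]⟩

lemma exists_rearrangement_mem_subsetFace (hu : Monotone u) (hu0 : ∀ i, 0 ≤ u i)
    (I : Finset (Fin n)) : ∃ σ : Equiv.Perm (Fin n),
      u ∘ σ ∈ subsetFace u I ∧ ∀ i ∈ I, ∀ k ∉ I, u (σ k) ≤ u (σ i) := by
  obtain ⟨σ, hσ⟩ := exists_perm_forall_mem_iff (card_topIndices (card_finset_fin_le I)).symm
  refine ⟨σ, mem_subsetFace.2
    ⟨comp_perm_mem_parkingRegion (self_mem_parkingRegion hu hu0) σ, ?_⟩, fun i hi k hk => hu ?_⟩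
  · rw [topSum_eq_sum_topIndices]
    exact Finset.sum_equiv σ hσ fun _ _ => rfl
  · rw [hσ, mem_topIndices] at hi hk
    exact Fin.le_def.2 (by omega)

lemma exists_mem_apply_ne_of_entryCount_lt (σ : Equiv.Perm (Fin n)) (hd : entryCount u d < #I) :
    ∃ i ∈ I, u (σ i) ≠ d := by
  by_contra! hconst
  have hsub : I.map σ.toEmbedding ⊆ ({i | u i = d} : Finset (Fin n)) := by
    intro j hj
    rw [Finset.mem_map_equiv] at hj
    simpa using hconst _ hj
  exact hd.not_ge (by simpa [entryCount] using Finset.card_le_card hsub)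

lemma apply_eq_of_mem_subsetFace (hu : Monotone u) (hd : ∀ i, u i ≤ d)
    (hI : #I ≤ entryCount u d) (hx : x ∈ subsetFace u I) {i : Fin n} (hi : i ∈ I) : x i = d := by
  rw [mem_subsetFace] at hx
  have hle (k : Fin n) : x k ≤ d := by
    have h := hx.1.1 {k} (Finset.singleton_nonempty k)
    rw [Finset.sum_singleton, Finset.card_singleton] at h
    simpa using h.trans (topSum_le_mul (Nat.one_le_of_lt k.isLt) hd)
  have hsum : ∑ k ∈ I, x k = ∑ _k ∈ I, d := by
    refine (Finset.sum_le_sum fun k _ => hle k).antisymm ?_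
    rw [Finset.sum_const, nsmul_eq_mul, hx.2]
    exact mul_le_topSum_of_le_entryCount hu hI
  exact (Finset.sum_eq_sum_iff_of_le fun k _ => hle k).1 hsum i hi

lemma apply_eq_zero_of_mem_subsetFace (hu : Monotone u) (hI : n ≤ #I + entryCount u 0)
    (hx : x ∈ subsetFace u I) {k : Fin n} (hk : k ∉ I) : x k = 0 := by
  rw [mem_subsetFace] at hx
  refine le_antisymm ?_ (hx.1.2 k)
  have hsum : x k + topSum u #I ≤ topSum u #I :=
    calc x k + topSum u #I = ∑ i ∈ insert k I, x i := by rw [Finset.sum_insert hk, hx.2]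
      _ ≤ ∑ i, x i := Finset.sum_le_univ_sum_of_nonneg hx.1.2
      _ ≤ ∑ i, u i := topSum_card_univ u ▸ hx.1.1 Finset.univ ⟨k, Finset.mem_univ k⟩
      _ ≤ topSum u #I := sum_le_topSum_of_le_add_entryCount_zero hu (card_finset_fin_le I) hI
  linarith

lemma forall_single_sub_single_mem_vectorSpan_subsetFace_iff (hu : Monotone u)
    (hu0 : ∀ i, 0 ≤ u i) (hd : IsGreatest (Set.range u) d) (hI : I.Nonempty) :
    (∀ i ∈ I, ∀ j ∈ I,
      (Pi.single i 1 - Pi.single j 1 : Fin n → ℝ) ∈ vectorSpan ℝ (subsetFace u I)) ↔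
      #I = 1 ∨ entryCount u d < #I := by
  constructor
  · intro hspan
    by_contra! hcard
    obtain ⟨i, hi, j, hj, hij⟩ := Finset.one_lt_card.1 (lt_of_le_of_ne hI.card_pos hcard.1.symm)
    have hker := vectorSpan_le_ker (LinearMap.proj i) (fun x hx =>
      apply_eq_of_mem_subsetFace hu (fun p => hd.2 ⟨p, rfl⟩) hcard.2 hx hi) (hspan i hi j hj)
    simp [hij] at hker
  · rintro (hcard | hcard) i hi j hj
    · rw [Finset.card_le_one.1 hcard.le i hi j hj, sub_self]
      exact Submodule.zero_mem _
    obtain ⟨σ, hσ, hσle⟩ := exists_rearrangement_mem_subsetFace hu hu0 I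
    obtain ⟨r, hr, hrd⟩ := exists_mem_apply_ne_of_entryCount_lt σ hcard
    obtain ⟨s, hs, hsd⟩ : ∃ s ∈ I, u (σ s) = d := by
      obtain ⟨p, rfl⟩ := hd.1
      by_cases hp : σ.symm p ∈ I
      · exact ⟨_, hp, by simp⟩
      · exact ⟨r, hr, (hd.2 ⟨_, rfl⟩).antisymm (by simpa using hσle r hr _ hp)⟩
    exact single_sub_single_mem_of_forall_ne (s := I)
      (fun p hp q hq => single_sub_single_mem_vectorSpan_of_comp_swap_mem hσ
        (comp_swap_mem_subsetFace hσ (iff_of_true hp hq)))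
      ⟨r, hr, s, hs, fun h => hrd (h.trans hsd)⟩ hi hj

lemma forall_single_mem_vectorSpan_subsetFace_iff (hu : Monotone u) (hu0 : ∀ i, 0 ≤ u i) :
    (∀ k ∉ I, (Pi.single k 1 : Fin n → ℝ) ∈ vectorSpan ℝ (subsetFace u I)) ↔
      #I = n ∨ #I + entryCount u 0 < n := by
  constructor
  · intro hspan
    by_contra! hcard
    obtain ⟨k, hk⟩ : ∃ k, k ∉ I := by
      by_contra! hall
      exact hcard.1 (by simp [Finset.eq_univ_iff_forall.2 hall])
    have hker := vectorSpan_le_ker (LinearMap.proj k) (fun x hx =>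
      apply_eq_zero_of_mem_subsetFace hu hcard.2 hx hk) (hspan k hk)
    simp at hker
  · rintro (hcard | hcard) k hk
    · exact absurd ((Finset.card_eq_iff_eq_univ I).1 (by simpa using hcard) ▸ Finset.mem_univ k) hk
    obtain ⟨σ, hσ, -⟩ := exists_rearrangement_mem_subsetFace hu hu0 I
    have hpos (l : Fin n) (hl : l ∉ I) (hul : (u ∘ σ) l ≠ 0) :=
      single_mem_vectorSpan_of_update_zero_mem hσ (update_zero_mem_subsetFace hσ hl) hul
    obtain ⟨l, hl, hul⟩ : ∃ l ∈ Iᶜ, u (σ l) ≠ 0 :=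
      exists_mem_apply_ne_of_entryCount_lt σ (by rw [Finset.card_compl, Fintype.card_fin]; omega)
    rw [Finset.mem_compl] at hl
    by_cases huk : u (σ k) = 0
    · have hsub := single_sub_single_mem_vectorSpan_of_comp_swap_mem hσ
        (comp_swap_mem_subsetFace hσ (iff_of_false hk hl)) (by simpa [huk] using hul.symm)
      simpa using Submodule.add_mem _ hsub (hpos l hl hul)
    · exact hpos k hk huk

end SubsetFace

section FacetCriterion

variable {n : ℕ} {u : Fin n → ℝ} {I : Finset (Fin n)} {d : ℝ}

lemma vectorSpan_parkingRegion (hu : Monotone u) (hu0 : ∀ i, 0 ≤ u i) (hne : u ≠ 0) :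
    vectorSpan ℝ (parkingRegion u) = ⊤ := by
  obtain ⟨p, hp⟩ := Function.ne_iff.1 hne
  refine eq_top_iff.2 fun v _ => mem_of_forall_single_mem fun j _ => ?_
  exact single_mem_vectorSpan_of_single_mem hp (zero_mem_parkingRegion hu hu0)
    (single_mem_parkingRegion hu hu0 j p)

theorem definesFacet_neg_single (hu : Monotone u) (hu0 : ∀ i, 0 ≤ u i) (hne : u ≠ 0) (i : Fin n) :
    DefinesFacet (PF u) (-Pi.single i 1) 0 := by
  rw [PF_eq_parkingRegion hu hu0, definesFacet_iff_forall_mem_vectorSpan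
    (vectorSpan_parkingRegion hu hu0 hne) (neg_ne_zero.2 (Pi.single_ne_zero_iff.2 one_ne_zero))
    (fun x hx => by simpa using hx.2 i) ⟨0, zero_mem_parkingRegion hu hu0, by simp⟩]
  obtain ⟨p, hp⟩ := Function.ne_iff.1 hne
  refine fun v hv => mem_of_forall_single_mem fun j hj => ?_
  have hij : i ≠ j := by
    rintro rfl
    exact hj (by simpa using hv)
  exact single_mem_vectorSpan_of_single_mem hp ⟨zero_mem_parkingRegion hu hu0, by simp⟩
    ⟨single_mem_parkingRegion hu hu0 j p, by simp [hij]⟩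

theorem definesFacet_indicatorVec_iff (hu : Monotone u) (hu0 : ∀ i, 0 ≤ u i) (hne : u ≠ 0)
    (hd : IsGreatest (Set.range u) d) (hI : I.Nonempty) :
    DefinesFacet (PF u) (indicatorVec I) (topSum u #I) ↔
      (#I = 1 ∨ entryCount u d < #I) ∧ (#I = n ∨ #I + entryCount u 0 < n) := by
  obtain ⟨σ, hσ, -⟩ := exists_rearrangement_mem_subsetFace hu hu0 I
  rw [PF_eq_parkingRegion hu hu0, definesFacet_iff_forall_mem_vectorSpan
    (vectorSpan_parkingRegion hu hu0 hne) (indicatorVec_ne_zero hI)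
    (fun x hx => (indicatorVec_dotProduct I x).trans_le (hx.1 I hI)) ⟨u ∘ σ, hσ⟩,
    forall_indicatorVec_dotProduct_eq_zero_imp_mem_iff hI]
  exact and_congr (forall_single_sub_single_mem_vectorSpan_subsetFace_iff hu hu0 hd hI)
    (forall_single_mem_vectorSpan_subsetFace_iff hu hu0)

theorem definesFacet_indicatorVec_iff_of_eq_ite {k : ℕ} (hk : k < n) (hd : 0 < d)
    (hud : ∀ i, u i = if i.val < k then 0 else d) (hI : I.Nonempty) :
    DefinesFacet (PF u) (indicatorVec I) (topSum u #I) ↔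
      (#I = 1 ∨ n - k < #I) ∧ (#I = n ∨ #I + k < n) := by
  have hu : Monotone u := fun i j hij => by
    rw [hud, hud]
    split_ifs <;> first | exact hd.le | exact le_rfl | omega
  have hu0 (i : Fin n) : 0 ≤ u i := by
    rw [hud]
    split_ifs <;> simp [hd.le]
  have hle (i : Fin n) : u i ≤ d := by
    rw [hud]
    split_ifs <;> simp [hd.le]
  have huk : u ⟨k, hk⟩ = d := by simp [hud]
  have hzero : entryCount u 0 = k := by
    simp [entryCount, hud, hd.ne', Fin.card_filter_val_lt, hk.le]
  have htop : entryCount u d = n - k := by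
    rw [entryCount, ← Fin.card_Ici ⟨k, hk⟩]
    congr 1
    ext i
    simp [hud, hd.ne, Fin.le_def]
  rw [definesFacet_indicatorVec_iff hu hu0 (fun h => hd.ne' (by simpa [h] using huk.symm))
    ⟨⟨_, huk⟩, Set.forall_mem_range.2 hle⟩ hI, hzero, htop]

lemma multiplicityVector_last (hd : IsGreatest (Set.range u) d) (hpos : 0 < d) :
    multiplicityVector u (Fin.last _) = entryCount u d := by
  have hmem : d ∈ posValues u := by simpa [posValues, hpos] using hd.1
  have hcard : 0 < numPosValues u := Finset.card_pos.2 ⟨d, hmem⟩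
  have hlast : Fin.last (numPosValues u) =
      Fin.succ ⟨numPosValues u - 1, Nat.sub_lt hcard one_pos⟩ :=
    Fin.ext (Nat.succ_pred_eq_of_pos hcard).symm
  have hmax : dataVector u ⟨numPosValues u - 1, Nat.sub_lt hcard one_pos⟩ =
      (posValues u).max' ⟨d, hmem⟩ := Finset.orderEmbOfFin_last rfl hcard
  rw [hlast, multiplicityVector, Fin.cons_succ, hmax]
  congr 1
  refine le_antisymm (Finset.max'_le _ _ _ fun e he => hd.2 ?_) (Finset.le_max' _ _ hmem)
  simpa using (Finset.mem_filter.1 he).1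

lemma entryCount_add_entryCount_lt {e : ℝ} {i : Fin n} (hde : d ≠ e) (hid : u i ≠ d)
    (hie : u i ≠ e) : entryCount u d + entryCount u e < n := by
  have hdisj : Disjoint ({i | u i = d} : Finset (Fin n)) ({i | u i = e} : Finset (Fin n)) :=
    Finset.disjoint_filter.2 fun j _ hjd hje => hde (hjd.symm.trans hje)
  rw [entryCount, entryCount, ← Finset.card_union_of_disjoint hdisj]
  simpa using Finset.card_lt_univ_of_notMem (x := i) (by simp [hid, hie])

theorem definesFacet_indicatorVec_iff_of_pos_of_pos (hu : Monotone u) (hu0 : ∀ i, 0 ≤ u i)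
    {i j : Fin n} (hi : 0 < u i) (hj : 0 < u j) (hij : u i ≠ u j) (hI : I.Nonempty) :
    DefinesFacet (PF u) (indicatorVec I) (topSum u #I) ↔
      #I ∈ ({1, n} ∪ Set.Icc (multiplicityVector u (Fin.last _) + 1)
        (n - multiplicityVector u 0 - 1) : Set ℕ) := by
  obtain ⟨q, hq⟩ : ∃ q, ∀ p, u p ≤ u q := by
    have := Nonempty.intro i
    exact Finite.exists_max u
  have hmax : IsGreatest (Set.range u) (u q) := ⟨⟨q, rfl⟩, Set.forall_mem_range.2 hq⟩
  have hpos : 0 < u q := hi.trans_le (hq i)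
  have hlt : entryCount u (u q) + entryCount u 0 < n := by
    by_cases hiq : u i = u q
    · exact entryCount_add_entryCount_lt hpos.ne' (hiq ▸ hij.symm) hj.ne'
    · exact entryCount_add_entryCount_lt hpos.ne' hiq hi.ne'
  have htop : 0 < entryCount u (u q) := Finset.card_pos.2 ⟨q, by simp⟩
  have hzero : multiplicityVector u 0 = entryCount u 0 := rfl
  have hIpos := hI.card_pos
  have hIn := card_finset_fin_le I
  rw [definesFacet_indicatorVec_iff hu hu0 (fun h => hi.ne' (congrFun h i)) hmax hI,
    multiplicityVector_last hmax hpos, hzero]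
  simp only [Set.mem_union, Set.mem_insert_iff, Set.mem_singleton_iff, Set.mem_Icc]
  omega

end FacetCriterion

theorem mainTheorem6 (n : ℕ) (u : Fin n → ℝ) (hmono : Monotone u) (hnonneg : ∀ i, 0 ≤ u i)
    (hne : u ≠ 0) :
    -- the inequality description
    PF u = {x : Fin n → ℝ |
        (∀ I : Finset (Fin n), I.Nonempty → ∑ i ∈ I, x i ≤ topSum u #I) ∧ ∀ i, 0 ≤ x i} ∧
    -- each `x i ≥ 0`, written `-x i ≤ 0`, defines a facet
    (∀ i : Fin n, DefinesFacet (PF u) (-Pi.single i 1) 0) ∧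
    -- `u = (d, …, d)`
    ((∃ d : ℝ, 0 < d ∧ ∀ i, u i = d) →
      ∀ I : Finset (Fin n), I.Nonempty →
        (DefinesFacet (PF u) (indicatorVec I) (topSum u #I) ↔ #I = 1)) ∧
    -- `u = (0, …, 0, d)`
    ((∃ d : ℝ, 0 < d ∧ ∀ i, u i = if i.val + 1 = n then d else 0) →
      ∀ I : Finset (Fin n), I.Nonempty →
        (DefinesFacet (PF u) (indicatorVec I) (topSum u #I) ↔ #I = n)) ∧
    -- `u = (0, …, 0, d, …, d)` with `k ≥ 1` zeros and at least two entries `d`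
    ((∃ d : ℝ, 0 < d ∧ ∃ k : ℕ, 1 ≤ k ∧ k + 2 ≤ n ∧ ∀ i, u i = if i.val < k then 0 else d) →
      ∀ I : Finset (Fin n), I.Nonempty →
        (DefinesFacet (PF u) (indicatorVec I) (topSum u #I) ↔ #I = 1 ∨ #I = n)) ∧
    -- `u` has at least two distinct positive entries
    ((∃ i j, 0 < u i ∧ 0 < u j ∧ u i ≠ u j) →
      ∀ I : Finset (Fin n), I.Nonempty →
        (DefinesFacet (PF u) (indicatorVec I) (topSum u #I) ↔
          #I ∈ ({1, n} ∪ Set.Icc (multiplicityVector u (Fin.last _) + 1)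
            (n - multiplicityVector u 0 - 1) : Set ℕ))) := by
  have hcard (I : Finset (Fin n)) (hI : I.Nonempty) : 0 < #I ∧ #I ≤ n :=
    ⟨hI.card_pos, card_finset_fin_le I⟩
  refine ⟨PF_eq_parkingRegion hmono hnonneg, definesFacet_neg_single hmono hnonneg hne,
    ?_, ?_, ?_, ?_⟩
  · rintro ⟨d, hd, hud⟩ I hI
    have := hcard I hI
    rw [definesFacet_indicatorVec_iff_of_eq_ite (k := 0) (by omega) hd (by simpa using hud) hI]
    omega
  · rintro ⟨d, hd, hud⟩ I hI
    have := hcard I hI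
    have hstep (i : Fin n) : u i = if i.val < n - 1 then 0 else d := by
      grind
    rw [definesFacet_indicatorVec_iff_of_eq_ite (by omega) hd hstep hI]
    omega
  · rintro ⟨d, hd, k, hk, hkn, hud⟩ I hI
    have := hcard I hI
    rw [definesFacet_indicatorVec_iff_of_eq_ite (by omega) hd hud hI]
    omega
  · rintro ⟨i, j, hi, hj, hij⟩ I hI
    exact definesFacet_indicatorVec_iff_of_pos_of_pos hmono hnonneg hi hj hij hI
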